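/- Let $\Xi=(\Xi_1,\dots,\Xi_d)$ have independent standard Gaussian coordinates and law $\mathbb P$ on $\mathbb R^d$. Let $\psi_1,\dots,\psi_P$, $P=\binom{d+p}{d}$, be the $d$-variate orthonormal probabilists' Hermite polynomials of total order at most $p$, that is, the products $\prod_{k=1}^d He_{i_k}(\xi_k)/\sqrt{i_k!}$ with $i_1+\dots+i_d\le p$. For a measurable $Q\subseteq\mathbb R^d$ of positive probability put $$\mu_Q=\sup_{1\le k\le P,\ \xi\in Q}|\psi_k(\xi)|^2,\qquad \mathbb P(Q)=\mathbb P(\Xi\in Q),\qquad \epsilon_Q=\big\|\mathbb E\big(X^TX\,\big|\,\Xi\in Q\big)-I\big\|_2 ,$$ where $X=(\psi_1(\Xi),\dots,\psi_P(\Xi))$ is a row vector and $\|\cdot\|_2$ is the spectral norm. For independent samples $\xi^{(1)},\dots,\xi^{(N)}$ of $\Xi$ let $\Psi\in\mathbb R^{N\times P}$ be the measurement matrix $\Psi(i,j)=\psi_j(\xi^{(i)})$, and let $\delta_s=\delta_s(N^{-1/2}\Psi)$ be the restricted isometry constant, i.e. the smallest $\delta\ge 0$ with $$(1-\delta)\|y\|_2^2\le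 \|N^{-1/2}\Psi y\|_2^2\le(1+\delta)\|y\|_2^2\quad\text{for all } y\in\mathbb R^P \text{ with at most } s \text{ nonzero entries.}$$ For all $0\le\epsilon_0<\tau$ there is a constant $C>0$, depending only on $\epsilon_0$ and $\tau$ (not on $d,p,s,Q,\delta_\star,p_\star$ or the number of samples), such that the following holds with $C_Q=C$ for every $Q$ with $\mu_Q<\infty$ and $\epsilon_Q\le\epsilon_0$, every $1\le s\le P$ and every threshold $\delta_\star\ge\tau$. If $N_\star\ge 1$ and $0\le p_\star<\mathbb P(Q)^{N_\star}$ satisfy $$N_\star\delta_\star\ \ge\ \frac{s\,\mu_Q}{C_Q}\Big[s+\log(2s)+s\log(P/s)-\log\big(\mathbb P(Q)^{N_\star}-p_\star\big)\Big],$$ then for $N=N_\star$ independent samples $\delta_s<\delta_\star$ holds with probability at least $p_\star$. -/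

import Mathlib

open MeasureTheory ProbabilityTheory
open scoped ENNReal

namespace SparsePCE

noncomputable section

/-- The law of the random input `Ξ = (Ξ₁, …, Ξ_d)`: independent standard Gaussian coordinates,
the orthogonality measure of the probabilists' Hermite polynomials. -/
def inputLaw (d : ℕ) : Measure (Fin d → ℝ) :=
  Measure.pi fun _ => gaussianReal 0 1

/-- Multi-indices `(i₁, …, i_d)` of total order at most `p`. (A bound on the sum bounds each entry,
so entries may be taken in `{0, …, p}`.) -/
abbrev MultiIndex (d p : ℕ) : Type :=
  {i : Fin d → Fin (p + 1) // ∑ k, (i k : ℕ) ≤ p}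

/-- The number `P` of basis functions. -/
def numBasis (d p : ℕ) : ℕ := Fintype.card (MultiIndex d p)

/-- The univariate orthonormal probabilists' Hermite polynomial `He_n / √(n!)`. -/
def hermiteNormalized (n : ℕ) (x : ℝ) : ℝ :=
  Polynomial.aeval x (Polynomial.hermite n) / √(n.factorial : ℝ)

/-- The multivariate orthonormal Hermite polynomial `ψ_i(ξ) = ∏ₖ ψ_{i_k}(ξ_k)`. -/
def basisFun {d p : ℕ} (i : MultiIndex d p) (ξ : Fin d → ℝ) : ℝ :=
  ∏ k, hermiteNormalized (i.1 k) (ξ k)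

/-- The measurement matrix `Ψ(i, j) = ψ_j(ξ⁽ⁱ⁾)`. -/
def measurementMatrix {d N : ℕ} (p : ℕ) (ξ : Fin N → Fin d → ℝ) :
    Matrix (Fin N) (MultiIndex d p) ℝ :=
  Matrix.of fun i j => basisFun j (ξ i)

/-- The coherence parameter `μ_Q = sup_{k, ξ ∈ Q} |ψ_k(ξ)|²`, possibly infinite. -/
def coherence (d p : ℕ) (Q : Set (Fin d → ℝ)) : ℝ≥0∞ :=
  ⨆ k : MultiIndex d p, ⨆ ξ ∈ Q, ENNReal.ofReal (|basisFun k ξ| ^ 2)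

/-- The matrix `E(Xᵀ X | ξ ∈ Q)`, where `X` is the row vector of all basis functions at `ξ`. -/
def truncatedGram (d p : ℕ) (Q : Set (Fin d → ℝ)) :
    Matrix (MultiIndex d p) (MultiIndex d p) ℝ :=
  Matrix.of fun i j => ∫ ξ, basisFun i ξ * basisFun j ξ ∂(inputLaw d)[|Q]

/-- The truncation bias `ε_Q = ‖E(Xᵀ X | ξ ∈ Q) - I‖₂` (spectral norm). -/
def truncationBias (d p : ℕ) (Q : Set (Fin d → ℝ)) : ℝ :=
  ‖Matrix.toEuclideanCLM (n := MultiIndex d p) (𝕜 := ℝ) (truncatedGram d p Q - 1)‖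

/-- The restricted isometry constant `δ_s(Φ)`: the smallest `δ ≥ 0` such that
`(1 - δ) ‖y‖₂² ≤ ‖Φ y‖₂² ≤ (1 + δ) ‖y‖₂²` for every `y` with at most `s` nonzero entries. -/
def ric {m n : Type*} [Fintype m] [Fintype n] (s : ℕ) (Φ : Matrix m n ℝ) : ℝ :=
  sInf {δ : ℝ | 0 ≤ δ ∧ ∀ y : n → ℝ, {j | y j ≠ 0}.ncard ≤ s →
    (1 - δ) * ∑ j, y j ^ 2 ≤ ∑ i, (Φ.mulVec y) i ^ 2 ∧
      ∑ i, (Φ.mulVec y) i ^ 2 ≤ (1 + δ) * ∑ j, y j ^ 2}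

end

end SparsePCE

namespace SparsePCE

/-! On `Q` the squared combination `(∑ zⱼ ψⱼ)²` of an `s`-sparse unit vector `z` lies in `[0, s
μ_Q]`, by Cauchy–Schwarz, and its conditional mean is at most `1 + ε₀`. A Chernoff bound restricted
to the event that all samples fall into `Q` (`measureReal_chernoff_truncated`) makes the empirical
Gram form deviate by more than `t` with probability at most `2 exp(-N (a t - a² (1 + ε₀)) / (s
μ_Q))`. Since `δstar ≥ τ > ε₀`, one fixed small `a` serves all thresholds, so the exponent is linear
in `δstar`.

A half-net of each coordinate sphere (`exists_testVectors`) and a union over the `P.choose s`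
supports make the bound uniform (`pow_le_measureReal_ric_le`). The conditional Gram matrix differs
from the identity by at most `ε₀`, which is added to the deviation. The sample size condition makes
the union bound at most `P(Q)^N - pstar` (`union_bound_le`). As all samples lie in `Q` with
probability `P(Q)^N`, at least `pstar` remains. -/

/-! ### Exponential moments and Chernoff bounds on the truncation event. -/

/-- From `e^v ≤ 1 + v + v²` for `|v| ≤ 1` and `u² ≤ u`. Linearity in `u` lets the exponential moment
depend on the mean alone. -/
lemma exp_mul_le_of_abs_le_one {a u : ℝ} (ha : |a| ≤ 1) (h0 : 0 ≤ u) (h1 : u ≤ 1) :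
    Real.exp (a * u) ≤ 1 + (a + a ^ 2) * u := by
  have hau : |a * u| ≤ 1 := by
    rw [abs_mul, abs_of_nonneg h0]
    exact mul_le_one₀ ha h0 h1
  have h := (abs_le.1 (Real.abs_exp_sub_one_sub_id_le hau)).2
  have h2 : (a * u) ^ 2 ≤ a ^ 2 * u := by
    rw [mul_pow]
    exact mul_le_mul_of_nonneg_left (by nlinarith) (sq_nonneg a)
  linarith

lemma setIntegral_eq_measureReal_mul_integral_cond {X : Type*} [MeasurableSpace X] {ν : Measure X}
    [IsFiniteMeasure ν] {Q : Set X} (hν : ν Q ≠ 0) (f : X → ℝ) :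
    ∫ x in Q, f x ∂ν = ν.real Q * ∫ x, f x ∂ν[|Q] := by
  have h : ν.real Q ≠ 0 := by simpa [measureReal_eq_zero_iff] using hν
  rw [ProbabilityTheory.cond, integral_smul_measure, ENNReal.toReal_inv, smul_eq_mul,
    ← mul_assoc]
  change _ = ν.real Q * (ν.real Q)⁻¹ * _
  rw [mul_inv_cancel₀ h, one_mul]

/-- An exponential moment bound for a bounded variable restricted to the event `Q`. -/
lemma integral_indicator_exp_le {X : Type*} [MeasurableSpace X] {ν : Measure X}
    [IsProbabilityMeasure ν] {Q : Set X} (hQ : MeasurableSet Q) (hν : ν Q ≠ 0) {f : X → ℝ}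
    (hf : Measurable f) {L : ℝ} (hL : 0 < L) (h0 : ∀ x ∈ Q, 0 ≤ f x) (h1 : ∀ x ∈ Q, f x ≤ L)
    {a : ℝ} (ha : |a| ≤ 1) :
    ∫ x, Q.indicator (fun x => Real.exp (a * (f x / L))) x ∂ν
      ≤ Real.exp ((a + a ^ 2) * ((∫ x, f x ∂ν[|Q]) / L)) := by
  have hfi : IntegrableOn f Q ν := by
    refine Measure.integrableOn_of_bounded (M := L) (measure_ne_top _ _) hf.aestronglyMeasurable ?_
    filter_upwards [ae_restrict_mem hQ] with x hx
    rw [Real.norm_eq_abs, abs_of_nonneg (h0 x hx)]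
    exact h1 x hx
  have hei : IntegrableOn (fun x => 1 + (a + a ^ 2) * (f x / L)) Q ν :=
    (integrable_const _).add ((hfi.div_const L).const_mul _)
  have hpt : ∀ x ∈ Q, Real.exp (a * (f x / L)) ≤ 1 + (a + a ^ 2) * (f x / L) := fun x hx =>
    exp_mul_le_of_abs_le_one ha (div_nonneg (h0 x hx) hL.le) ((div_le_one hL).2 (h1 x hx))
  have hexpi : IntegrableOn (fun x => Real.exp (a * (f x / L))) Q ν := by
    refine hei.mono' (by fun_prop) ?_
    filter_upwards [ae_restrict_mem hQ] with x hx
    rw [Real.norm_eq_abs, abs_of_pos (Real.exp_pos _)]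
    exact hpt x hx
  rw [integral_indicator hQ]
  calc ∫ x in Q, Real.exp (a * (f x / L)) ∂ν
      ≤ ∫ x in Q, (1 + (a + a ^ 2) * (f x / L)) ∂ν := setIntegral_mono_on hexpi hei hQ hpt
    _ = ν.real Q * (1 + (a + a ^ 2) * ((∫ x, f x ∂ν[|Q]) / L)) := by
        rw [integral_add (integrable_const _) ((hfi.div_const L).const_mul _), integral_const_mul,
          integral_div, setIntegral_eq_measureReal_mul_integral_cond hν f]
        simp
        ring
    -- The factor `ν(Q) ≤ 1` is dropped; then `1 + v ≤ e^v`.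
    _ ≤ Real.exp ((a + a ^ 2) * ((∫ x, f x ∂ν[|Q]) / L)) := by
        have hq : ν.real Q ≤ 1 := measureReal_le_one
        have hq0 : 0 ≤ ν.real Q := measureReal_nonneg
        have he := Real.add_one_le_exp ((a + a ^ 2) * ((∫ x, f x ∂ν[|Q]) / L))
        have hp := Real.exp_pos ((a + a ^ 2) * ((∫ x, f x ∂ν[|Q]) / L))
        nlinarith

/-- Chernoff bound for a sum of independent copies of `f`, on the event that all samples fall into
a set `Q` on which `0 ≤ f ≤ L`. -/
lemma measureReal_chernoff_truncated {X Ω : Type*} [MeasurableSpace X] [MeasurableSpace Ω]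
    {ν : Measure X} [IsProbabilityMeasure ν] {Pr : Measure Ω} [IsProbabilityMeasure Pr]
    {Q : Set X} (hQ : MeasurableSet Q) (hν : ν Q ≠ 0) {f : X → ℝ}
    (hf : Measurable f) {L : ℝ} (hL : 0 < L) (h0 : ∀ x ∈ Q, 0 ≤ f x) (h1 : ∀ x ∈ Q, f x ≤ L)
    {N : ℕ} {ξ : Fin N → Ω → X} (hlaw : ∀ i, HasLaw (ξ i) ν Pr) (hind : iIndepFun ξ Pr)
    {a : ℝ} (ha : |a| ≤ 1) (u : ℝ) :
    Pr.real {ω | (∀ i, ξ i ω ∈ Q) ∧ u ≤ a * ∑ i, f (ξ i ω)}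
      ≤ Real.exp ((N * ((a + a ^ 2) * ∫ x, f x ∂ν[|Q]) - u) / L) := by
  -- The indicator inside `g` kills the product once a sample leaves `Q`, so the samples stay
  -- independent and need no conditioning.
  set g : X → ℝ := Q.indicator (fun x => Real.exp (a * (f x / L))) with hg
  have hgm : Measurable g := by
    have : Measurable fun x => Real.exp (a * (f x / L)) := by fun_prop
    exact this.indicator hQ
  have hg0 : ∀ x, 0 ≤ g x := fun x => Set.indicator_nonneg (fun _ _ => (Real.exp_pos _).le) x
  have hgb : ∀ x, g x ≤ Real.exp 1 := by
    intro x
    by_cases hx : x ∈ Q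
    · rw [hg, Set.indicator_of_mem hx, Real.exp_le_exp]
      have h2 : |f x / L| ≤ 1 := by
        rw [abs_of_nonneg (div_nonneg (h0 x hx) hL.le)]
        exact (div_le_one hL).2 (h1 x hx)
      refine (le_abs_self _).trans ?_
      rw [abs_mul]
      exact mul_le_one₀ ha (abs_nonneg _) h2
    · rw [hg, Set.indicator_of_notMem hx]
      exact (Real.exp_pos _).le
  have hgc : ∀ i, AEStronglyMeasurable (fun ω => g (ξ i ω)) Pr := fun i =>
    (hgm.comp_aemeasurable (hlaw i).aemeasurable).aestronglyMeasurable
  have hprod : ∫ ω, ∏ i, g (ξ i ω) ∂Pr = (∫ x, g x ∂ν) ^ N := by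
    have hI : iIndepFun (fun i ω => g (ξ i ω)) Pr := hind.comp (fun _ => g) fun _ => hgm
    rw [hI.integral_fun_prod_eq_prod_integral hgc]
    have : ∀ i, ∫ ω, g (ξ i ω) ∂Pr = ∫ x, g x ∂ν := fun i =>
      (hlaw i).integral_comp hgm.aestronglyMeasurable
    simp [this]
  have hint : Integrable (fun ω => ∏ i, g (ξ i ω)) Pr := by
    refine Integrable.of_bound (C := Real.exp 1 ^ N)
      (Finset.aestronglyMeasurable_fun_prod _ fun i _ => hgc i) ?_
    filter_upwards with ω
    rw [Real.norm_eq_abs, abs_of_nonneg (Finset.prod_nonneg fun i _ => hg0 _)]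
    calc ∏ i, g (ξ i ω) ≤ ∏ _i : Fin N, Real.exp 1 :=
          Finset.prod_le_prod (fun i _ => hg0 _) fun i _ => hgb _
      _ = Real.exp 1 ^ N := by simp
  have hsub : {ω | (∀ i, ξ i ω ∈ Q) ∧ u ≤ a * ∑ i, f (ξ i ω)}
      ⊆ {ω | Real.exp (u / L) ≤ ∏ i, g (ξ i ω)} := by
    rintro ω ⟨hω, hu⟩
    have : ∏ i, g (ξ i ω) = Real.exp (a * (∑ i, f (ξ i ω)) / L) := by
      rw [Finset.prod_congr rfl fun i _ => Set.indicator_of_mem (hω i) _, ← Real.exp_sum,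
        Finset.mul_sum, Finset.sum_div]
      simp only [mul_div_assoc]
    change Real.exp (u / L) ≤ ∏ i, g (ξ i ω)
    rw [this]
    gcongr
  have hmarkov := mul_meas_ge_le_integral_of_nonneg
    (Filter.Eventually.of_forall fun ω => Finset.prod_nonneg fun i _ => hg0 (ξ i ω)) hint
    (Real.exp (u / L))
  have hmono := measureReal_mono (μ := Pr) hsub
  have hpow : (∫ x, g x ∂ν) ^ N
      ≤ Real.exp ((a + a ^ 2) * ((∫ x, f x ∂ν[|Q]) / L)) ^ N :=
    pow_le_pow_left₀ (integral_nonneg hg0) (integral_indicator_exp_le hQ hν hf hL h0 h1 ha) N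
  rw [hprod] at hmarkov
  rw [← Real.exp_nat_mul] at hpow
  have hkey : Real.exp (u / L) * Pr.real {ω | (∀ i, ξ i ω ∈ Q) ∧ u ≤ a * ∑ i, f (ξ i ω)}
      ≤ Real.exp (N * ((a + a ^ 2) * ((∫ x, f x ∂ν[|Q]) / L))) :=
    (mul_le_mul_of_nonneg_left hmono (Real.exp_pos _).le).trans (hmarkov.trans hpow)
  have : (N * ((a + a ^ 2) * ∫ x, f x ∂ν[|Q]) - u) / L
      = N * ((a + a ^ 2) * ((∫ x, f x ∂ν[|Q]) / L)) - u / L := by ring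
  rw [this, Real.exp_sub, le_div_iff₀ (Real.exp_pos _), mul_comm]
  exact hkey

/-! ### Nets and quadratic forms. -/

/-- The unit sphere has a `1/2`-net with at most `5 ^ dim` points. -/
lemma exists_half_net_sphere (E : Type*) [NormedAddCommGroup E] [NormedSpace ℝ E]
    [FiniteDimensional ℝ E] :
    ∃ T : Finset E, T.card ≤ 5 ^ Module.finrank ℝ E ∧ (∀ z ∈ T, ‖z‖ = 1) ∧
      ∀ y : E, ‖y‖ = 1 → ∃ z ∈ T, ‖y - z‖ ≤ 1 / 2 := by
  classical
  let p : Finset E → Prop := fun T =>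
    (∀ z ∈ T, ‖z‖ = 1) ∧ ∀ z ∈ T, ∀ w ∈ T, z ≠ w → 1 / 2 ≤ ‖z - w‖
  have hcard : ∀ T, p T → T.card ≤ 5 ^ Module.finrank ℝ E := by
    rintro T ⟨h1, h2⟩
    -- Doubling turns `1/2`-separated unit vectors into `1`-separated vectors of norm `2`, the
    -- normalization of `Besicovitch.card_le_of_separated`.
    have hinj : Function.Injective fun z : E => (2 : ℝ) • z := smul_right_injective E two_ne_zero
    rw [← Finset.card_image_of_injective T hinj]
    refine Besicovitch.card_le_of_separated _ ?_ ?_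
    · simp only [Finset.mem_image]
      rintro _ ⟨z, hz, rfl⟩
      simp [norm_smul, h1 z hz]
    · simp only [Finset.mem_image]
      rintro _ ⟨z, hz, rfl⟩ _ ⟨w, hw, rfl⟩ hne
      have := h2 z hz w hw fun h => hne (by rw [h])
      rw [← smul_sub, norm_smul, Real.norm_ofNat]
      linarith
  -- A separated set of maximal cardinality is a net: a point far from it could be added.
  obtain ⟨k, ⟨T, hT, rfl⟩, hmax⟩ : ∃ k, (∃ T, p T ∧ T.card = k) ∧
      ∀ T, p T → T.card ≤ k := by
    let R : ℕ → Prop := fun k => ∃ T, p T ∧ T.card = k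
    have hR0 : R 0 := ⟨∅, by simp [p], rfl⟩
    refine ⟨Nat.findGreatest R (5 ^ Module.finrank ℝ E),
      Nat.findGreatest_spec (P := R) (Nat.zero_le _) hR0, fun T hT => ?_⟩
    exact Nat.le_findGreatest (hcard T hT) ⟨T, hT, rfl⟩
  refine ⟨T, hcard T hT, hT.1, fun y hy => ?_⟩
  by_contra! hfar
  have hyT : y ∉ T := fun h => by
    have := hfar y h
    norm_num at this
  have hp : p (insert y T) := by
    refine ⟨?_, ?_⟩
    · simp only [Finset.mem_insert]
      rintro z (rfl | hz)
      exacts [hy, hT.1 z hz]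
    · simp only [Finset.mem_insert]
      rintro z (rfl | hz) w (rfl | hw) hne
      · exact absurd rfl hne
      · exact (hfar w hw).le
      · rw [norm_sub_rev]
        exact (hfar z hz).le
      · exact hT.2 z hz w hw hne
  have := hmax _ hp
  rw [Finset.card_insert_of_notMem hyT] at this
  omega

/-- The hypotheses give `⟪y, z⟫ ≥ 7/8`, and `25 + 9 - 30 * (7/8) = 31/4`. -/
lemma norm_smul_sub_smul_sq_le {E : Type*} [NormedAddCommGroup E] [InnerProductSpace ℝ E] {y z : E}
    (hy : ‖y‖ = 1) (hz : ‖z‖ = 1) (h : ‖y - z‖ ≤ 1 / 2) :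
    ‖(5 : ℝ) • y - (3 : ℝ) • z‖ ^ 2 ≤ 31 / 4 := by
  have h1 := norm_sub_sq_real y z
  have h2 := norm_sub_sq_real ((5 : ℝ) • y) ((3 : ℝ) • z)
  rw [real_inner_smul_left, real_inner_smul_right, norm_smul, norm_smul, hy, hz] at h2
  rw [hy, hz] at h1
  norm_num at h2
  have h3 : ‖y - z‖ ^ 2 ≤ (1 / 2) ^ 2 := pow_le_pow_left₀ (norm_nonneg _) h 2
  linarith

/-- A quadratic form that is at most `t` in absolute value on a `1/2`-net of the unit sphere is at
most `32 * t` on the sphere. -/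
lemma abs_quadraticForm_le_of_half_net {E : Type*} [NormedAddCommGroup E] [InnerProductSpace ℝ E]
    [FiniteDimensional ℝ E] (q : QuadraticForm ℝ E) (hq : Continuous q) {T : Finset E}
    (hT1 : ∀ z ∈ T, ‖z‖ = 1) (hT2 : ∀ y : E, ‖y‖ = 1 → ∃ z ∈ T, ‖y - z‖ ≤ 1 / 2)
    {t : ℝ} (ht : ∀ z ∈ T, |q z| ≤ t) (y : E) :
    |q y| ≤ 32 * t * ‖y‖ ^ 2 := by
  rcases eq_or_ne y 0 with rfl | hy0
  · simp
  have hscale : ∀ (M : ℝ), (∀ y : E, ‖y‖ = 1 → |q y| ≤ M) → ∀ y, |q y| ≤ M * ‖y‖ ^ 2 := by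
    intro M hM y
    rcases eq_or_ne y 0 with rfl | hy0
    · simp
    have hn : 0 < ‖y‖ := norm_pos_iff.2 hy0
    have h := hM (‖y‖⁻¹ • y) (norm_smul_inv_norm hy0)
    rw [QuadraticMap.map_smul, smul_eq_mul, abs_mul, abs_of_nonneg (by positivity),
      ← mul_inv, inv_mul_le_iff₀ (by positivity)] at h
    linarith
  obtain ⟨v, hv, hvmax⟩ := (isCompact_sphere (0 : E) 1).exists_isMaxOn
    ⟨‖y‖⁻¹ • y, by simpa using norm_smul_inv_norm (𝕜 := ℝ) hy0⟩ hq.abs.continuousOn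
  have hv1 : ‖v‖ = 1 := by simpa using hv
  have hM : ∀ y : E, ‖y‖ = 1 → |q y| ≤ |q v| := fun w hw => hvmax (by simpa using hw)
  obtain ⟨z, hz, hvz⟩ := hT2 v hv1
  have hz1 := hT1 z hz
  -- The polar terms cancel. At the maximizer `v` this yields `|q v - q z| ≤ (31/32) |q v|`, a
  -- strict contraction, whence the factor `32`.
  have hid : q v - q z
      = (q ((5 : ℝ) • v - (3 : ℝ) • z) - q ((5 : ℝ) • z - (3 : ℝ) • v)) / 16 := by
    have key : ∀ (a b : ℝ) (x w : E), q (a • x - b • w)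
        = a ^ 2 * q x + b ^ 2 * q w - a * b * QuadraticMap.polar q x w := by
      intro a b x w
      rw [sub_eq_add_neg, ← neg_smul, QuadraticMap.map_add q, QuadraticMap.map_smul,
        QuadraticMap.map_smul, QuadraticMap.polar_smul_left, QuadraticMap.polar_smul_right]
      simp only [smul_eq_mul]
      ring
    rw [key, key, QuadraticMap.polar_comm q z v]
    ring
  have h1 := hscale _ hM ((5 : ℝ) • v - (3 : ℝ) • z)
  have h2 := hscale _ hM ((5 : ℝ) • z - (3 : ℝ) • v)
  have h3 := norm_smul_sub_smul_sq_le hv1 hz1 hvz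
  have h4 := norm_smul_sub_smul_sq_le hz1 hv1 (by rwa [norm_sub_rev])
  have h5 := ht z hz
  have h6 := mul_le_mul_of_nonneg_left h3 (abs_nonneg (q v))
  have h7 := mul_le_mul_of_nonneg_left h4 (abs_nonneg (q v))
  have h8 : |q v| ≤ |q z| + |q v - q z| := by
    have := abs_add_le (q z) (q v - q z)
    rwa [add_sub_cancel] at this
  have h9 : |q v - q z| ≤ (|q v| * (31 / 4) + |q v| * (31 / 4)) / 16 := by
    rw [hid, abs_div, abs_of_pos (by norm_num : (0 : ℝ) < 16)]
    have := abs_sub (q ((5 : ℝ) • v - (3 : ℝ) • z)) (q ((5 : ℝ) • z - (3 : ℝ) • v))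
    gcongr
    linarith
  have h10 : |q v| ≤ 32 * t := by linarith
  exact (hscale _ hM y).trans (mul_le_mul_of_nonneg_right h10 (sq_nonneg _))

open Matrix in
/-- The unit sphere of the coordinate subspace of vectors supported in `S` has a finite set of test
vectors, at most `5 ^ |S|` many, that controls every quadratic form on this subspace. -/
lemma exists_testVectors {n : Type*} [Fintype n] (S : Finset n) :
    ∃ T : Finset (n → ℝ), T.card ≤ 5 ^ S.card ∧ (∀ z ∈ T, ∑ j, z j ^ 2 = 1) ∧
      (∀ z ∈ T, ∀ j ∉ S, z j = 0) ∧
      ∀ (A : Matrix n n ℝ) (t : ℝ), (∀ z ∈ T, |z ⬝ᵥ A *ᵥ z| ≤ t) →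
        ∀ y : n → ℝ, (∀ j ∉ S, y j = 0) → |y ⬝ᵥ A *ᵥ y| ≤ 32 * t * ∑ j, y j ^ 2 := by
  classical
  let ext : EuclideanSpace ℝ S →ₗ[ℝ] (n → ℝ) :=
    (Function.ExtendByZero.linearMap ℝ ((↑) : S → n)).comp
      (WithLp.linearEquiv 2 ℝ (S → ℝ)).toLinearMap
  have hext : ∀ y (j : S), ext y j = y j := fun y j =>
    Subtype.val_injective.extend_apply _ _ j
  have hext0 : ∀ y, ∀ j ∉ S, ext y j = 0 := fun y j hj =>
    Function.extend_apply' _ _ _ fun ⟨i, hi⟩ => hj (hi ▸ i.2)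
  have hnorm : ∀ y, ∑ j, ext y j ^ 2 = ‖y‖ ^ 2 := by
    intro y
    rw [EuclideanSpace.real_norm_sq_eq, ← Finset.sum_subset (Finset.subset_univ S)
      (fun j _ hj => by simp [hext0 y j hj]), ← Finset.sum_coe_sort]
    simp only [hext]
  obtain ⟨T, hcard, hT1, hT2⟩ := exists_half_net_sphere (EuclideanSpace ℝ S)
  refine ⟨T.image ext, Finset.card_image_le.trans (by simpa using hcard), ?_, ?_, ?_⟩
  · simp only [Finset.mem_image]
    rintro _ ⟨z, hz, rfl⟩
    rw [hnorm, hT1 z hz, one_pow]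
  · simp only [Finset.mem_image]
    rintro _ ⟨z, hz, rfl⟩ j hj
    exact hext0 z j hj
  · intro A t ht y hy
    have hval : ∀ v, A.toQuadraticForm'.comp ext v = ext v ⬝ᵥ A *ᵥ ext v := fun v => by
      
      rw [QuadraticMap.comp_apply, Matrix.toQuadraticForm', LinearMap.BilinMap.toQuadraticMap_apply,
        Matrix.toLinearMap₂'_apply']
    have hextc : Continuous ext := ext.continuous_of_finiteDimensional
    have hcont : Continuous (A.toQuadraticForm'.comp ext) := by
      have : (A.toQuadraticForm'.comp ext : EuclideanSpace ℝ S → ℝ)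
          = fun v => ext v ⬝ᵥ A *ᵥ ext v := funext hval
      rw [this]
      exact hextc.dotProduct (continuous_const.matrix_mulVec hextc)
    have h := abs_quadraticForm_le_of_half_net (A.toQuadraticForm'.comp ext) hcont hT1 hT2 (t := t)
      (fun z hz => by rw [hval]; exact ht _ (Finset.mem_image_of_mem _ hz))
      (WithLp.toLp 2 fun j => y j)
    have hy' : ext (WithLp.toLp 2 fun j => y j) = y := by
      ext j
      by_cases hj : j ∈ S
      · exact hext _ ⟨j, hj⟩
      · rw [hext0 _ j hj, hy j hj]
    rwa [hval, ← hnorm, hy'] at h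

/-! ### From test vectors to the restricted isometry constant. -/

noncomputable section Deterministic

variable {n : Type*} [Fintype n] {X : Type*} (ψ : n → X → ℝ)

/-- The sampling matrix `(i, j) ↦ ψ_j(x_i)`. -/
def samplingMatrix {N : ℕ} (x : Fin N → X) : Matrix (Fin N) n ℝ := Matrix.of fun i j => ψ j (x i)

/-- The square of the linear combination `∑ⱼ zⱼ ψⱼ`. -/
def sqComb (z : n → ℝ) (x : X) : ℝ := (∑ j, z j * ψ j x) ^ 2

lemma sqComb_nonneg (z : n → ℝ) (x : X) : 0 ≤ sqComb ψ z x := sq_nonneg _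

lemma measurable_sqComb [MeasurableSpace X] (hψ : ∀ j, Measurable (ψ j)) (z : n → ℝ) :
    Measurable (sqComb ψ z) := by
  unfold sqComb
  fun_prop

/-- Cauchy–Schwarz on the support; this is the source of the factor `s μ_Q` in the sample size. -/
lemma sqComb_le {z : n → ℝ} {S : Finset n} (hz : ∀ j ∉ S, z j = 0) (hz1 : ∑ j, z j ^ 2 = 1)
    {x : X} {μ : ℝ} (hμ : ∀ j, ψ j x ^ 2 ≤ μ) : sqComb ψ z x ≤ S.card * μ := by
  have h1 : ∑ j, z j * ψ j x = ∑ j ∈ S, z j * ψ j x :=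
    (Finset.sum_subset (Finset.subset_univ S) fun j _ hj => by simp [hz j hj]).symm
  have h2 : ∑ j ∈ S, z j ^ 2 = 1 := by
    rw [← hz1]
    exact Finset.sum_subset (Finset.subset_univ S) fun j _ hj => by simp [hz j hj]
  calc sqComb ψ z x = (∑ j ∈ S, z j * ψ j x) ^ 2 := by rw [sqComb, h1]
    _ ≤ (∑ j ∈ S, z j ^ 2) * ∑ j ∈ S, ψ j x ^ 2 := Finset.sum_mul_sq_le_sq_mul_sq _ _ _
    _ ≤ S.card * μ := by
      rw [h2, one_mul, ← nsmul_eq_mul]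
      exact Finset.sum_le_card_nsmul _ _ _ fun j _ => hμ j

lemma sum_sq_smul_samplingMatrix_mulVec {N : ℕ} (x : Fin N → X) (y : n → ℝ) :
    ∑ i, (((√(N : ℝ))⁻¹ • samplingMatrix ψ x).mulVec y) i ^ 2
      = (N : ℝ)⁻¹ * ∑ i, sqComb ψ y (x i) := by
  rw [Finset.mul_sum]
  refine Finset.sum_congr rfl fun i _ => ?_
  rw [Matrix.smul_mulVec, Pi.smul_apply, smul_eq_mul, mul_pow, inv_pow,
    Real.sq_sqrt (Nat.cast_nonneg N), sqComb]
  simp [samplingMatrix, Matrix.mulVec, dotProduct, mul_comm]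

lemma dotProduct_mulVec_eq_sum (A : Matrix n n ℝ) (y : n → ℝ) :
    y ⬝ᵥ A.mulVec y = ∑ i, ∑ j, y i * y j * A i j := by
  simp only [dotProduct, Matrix.mulVec, Finset.mul_sum]
  refine Finset.sum_congr rfl fun i _ => Finset.sum_congr rfl fun j _ => by ring

lemma sqComb_eq_sum (y : n → ℝ) (x : X) :
    sqComb ψ y x = ∑ i, ∑ j, y i * y j * (ψ i x * ψ j x) := by
  rw [sqComb, sq, Finset.sum_mul_sum]
  refine Finset.sum_congr rfl fun i _ => Finset.sum_congr rfl fun j _ => by ring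

/-- The difference of the empirical Gram matrix of a sample and a given matrix `G`. -/
def gramError {N : ℕ} (G : Matrix n n ℝ) (x : Fin N → X) : Matrix n n ℝ :=
  Matrix.of fun j k => (N : ℝ)⁻¹ * ∑ i, ψ j (x i) * ψ k (x i) - G j k

lemma dotProduct_gramError_mulVec {N : ℕ} (G : Matrix n n ℝ) (x : Fin N → X) (y : n → ℝ) :
    y ⬝ᵥ (gramError ψ G x).mulVec y
      = (N : ℝ)⁻¹ * ∑ i, sqComb ψ y (x i) - y ⬝ᵥ G.mulVec y := by
  simp only [dotProduct_mulVec_eq_sum, sqComb_eq_sum, gramError, Matrix.of_apply, mul_sub,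
    Finset.sum_sub_distrib]
  congr 1
  simp only [Finset.mul_sum]
  conv_rhs => rw [Finset.sum_comm]
  refine Finset.sum_congr rfl fun j _ => ?_
  rw [Finset.sum_comm]
  refine Finset.sum_congr rfl fun k _ => Finset.sum_congr rfl fun i _ => by ring

lemma abs_dotProduct_mulVec_sub_le [DecidableEq n] (G : Matrix n n ℝ) (y : n → ℝ) :
    |y ⬝ᵥ G.mulVec y - ∑ j, y j ^ 2|
      ≤ ‖Matrix.toEuclideanCLM (n := n) (𝕜 := ℝ) (G - 1)‖ * ∑ j, y j ^ 2 := by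
  have h1 := Matrix.inner_toEuclideanCLM (G - 1) (WithLp.toLp 2 y) (WithLp.toLp 2 y)
  have h2 : y ⬝ᵥ (G - 1).mulVec y = y ⬝ᵥ G.mulVec y - ∑ j, y j ^ 2 := by
    rw [Matrix.sub_mulVec, dotProduct_sub, Matrix.one_mulVec]
    simp [dotProduct, sq]
  have h3 : ‖WithLp.toLp 2 y‖ ^ 2 = ∑ j, y j ^ 2 := EuclideanSpace.real_norm_sq_eq _
  rw [← h2, ← h3]
  change _ = y ⬝ᵥ (G - 1).mulVec y at h1
  rw [← h1]
  refine (abs_real_inner_le_norm _ _).trans ?_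
  have := mul_le_mul_of_nonneg_left
    ((Matrix.toEuclideanCLM (n := n) (𝕜 := ℝ) (G - 1)).le_opNorm (WithLp.toLp 2 y))
    (norm_nonneg (WithLp.toLp 2 y))
  linarith

/-- If the empirical Gram matrix is close to `G` on test vectors and `G` is close to the identity,
then the restricted isometry constant is small. -/
lemma ric_le_of_testVectors [DecidableEq n] {N s : ℕ} (hs : s ≤ Fintype.card n)
    {G : Matrix n n ℝ} {ε t : ℝ} (hG : ‖Matrix.toEuclideanCLM (n := n) (𝕜 := ℝ) (G - 1)‖ ≤ ε)
    (ht : 0 ≤ t) (x : Fin N → X) (T : Finset n → Finset (n → ℝ))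
    (hT : ∀ S, ∀ (A : Matrix n n ℝ) (t : ℝ), (∀ z ∈ T S, |z ⬝ᵥ A.mulVec z| ≤ t) →
        ∀ y : n → ℝ, (∀ j ∉ S, y j = 0) → |y ⬝ᵥ A.mulVec y| ≤ 32 * t * ∑ j, y j ^ 2)
    (h : ∀ S : Finset n, S.card = s → ∀ z ∈ T S, |z ⬝ᵥ (gramError ψ G x).mulVec z| ≤ t) :
    ric s ((√(N : ℝ))⁻¹ • samplingMatrix ψ x) ≤ 32 * t + ε := by
  have hε : 0 ≤ ε := (norm_nonneg _).trans hG
  refine csInf_le ⟨0, fun δ hδ => hδ.1⟩ ⟨by positivity, fun y hy => ?_⟩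
  have hfin : (Finset.univ.filter fun j => y j ≠ 0).card ≤ s := by
    rw [← Set.ncard_coe_finset]
    simpa using hy
  -- Enlarging the support to exactly `s` indices means only supports of that size enter the union
  -- bound.
  obtain ⟨S, hsub, -, hS⟩ := Finset.exists_subsuperset_card_eq
    (Finset.subset_univ (Finset.univ.filter fun j => y j ≠ 0)) hfin
    (by simpa using hs)
  have hyS : ∀ j ∉ S, y j = 0 := fun j hj => by
    by_contra hne
    exact hj (hsub (by simpa using hne))
  have h1 := hT S _ t (h S hS) y hyS
  have h2 := (abs_dotProduct_mulVec_sub_le G y).trans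
    (mul_le_mul_of_nonneg_right hG (Finset.sum_nonneg fun j _ => sq_nonneg (y j)))
  rw [dotProduct_gramError_mulVec] at h1
  rw [sum_sq_smul_samplingMatrix_mulVec]
  rw [abs_le] at h1 h2
  constructor <;> linarith [h1.1, h1.2, h2.1, h2.2]

end Deterministic

/-! ### Counting, deviation and union bounds. -/

/-- Combines `P.choose s ≤ P^s / s!` with `s^s / s! ≤ e^s`. -/
lemma choose_le_exp {P s : ℕ} (hs : 1 ≤ s) (hsP : s ≤ P) :
    (P.choose s : ℝ) ≤ Real.exp (s + s * Real.log ((P : ℝ) / s)) := by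
  have hs0 : (0 : ℝ) < s := by exact_mod_cast hs
  have hP0 : (0 : ℝ) < P := by exact_mod_cast hs.trans hsP
  have h1 : (P.choose s : ℝ) ≤ (P : ℝ) ^ s / s.factorial := Nat.choose_le_pow_div s P
  have h2 := Real.pow_div_factorial_le_exp (s : ℝ) hs0.le s
  have h3 : Real.exp (s * Real.log ((P : ℝ) / s)) = ((P : ℝ) / s) ^ s := by
    rw [Real.exp_nat_mul, Real.exp_log (by positivity)]
  rw [Real.exp_add, h3]
  calc (P.choose s : ℝ) ≤ (P : ℝ) ^ s / s.factorial := h1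
    _ = (s : ℝ) ^ s / s.factorial * ((P : ℝ) / s) ^ s := by
      rw [div_pow]
      field_simp
    _ ≤ Real.exp s * ((P : ℝ) / s) ^ s := by gcongr

lemma measureReal_forall_mem_eq_pow {X Ω : Type*} [MeasurableSpace X] [MeasurableSpace Ω]
    {ν : Measure X} {Pr : Measure Ω} {Q : Set X} (hQ : MeasurableSet Q) {N : ℕ}
    {ξ : Fin N → Ω → X} (hlaw : ∀ i, HasLaw (ξ i) ν Pr) (hind : iIndepFun ξ Pr) :
    Pr.real {ω | ∀ i, ξ i ω ∈ Q} = ν.real Q ^ N := by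
  have h := hind.meas_iInter (s := fun i => ξ i ⁻¹' Q) fun i => ⟨Q, hQ, rfl⟩
  have h1 : {ω | ∀ i, ξ i ω ∈ Q} = ⋂ i, ξ i ⁻¹' Q := by
    ext ω
    simp
  have h2 : ∀ i, Pr (ξ i ⁻¹' Q) = ν Q := fun i => (hlaw i).measure_eq hQ
  rw [h1, Measure.real, h, ENNReal.toReal_prod]
  simp [h2, Measure.real]

/-- A function system that is square-bounded on `Q` has integrable products under `ν[|Q]`. -/
lemma integrable_mul_cond {n X : Type*} [MeasurableSpace X] {ψ : n → X → ℝ} {ν : Measure X}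
    (hψ : ∀ j, Measurable (ψ j)) {Q : Set X} (hQ : MeasurableSet Q)
    {μ : ℝ} (hμ : ∀ j, ∀ x ∈ Q, ψ j x ^ 2 ≤ μ) (i j : n) :
    Integrable (fun x => ψ i x * ψ j x) ν[|Q] := by
  refine Integrable.of_bound (C := μ) ((hψ i).mul (hψ j)).aestronglyMeasurable ?_
  filter_upwards [ae_cond_mem hQ] with x hx
  have h1 := hμ i x hx
  have h2 := hμ j x hx
  rw [Real.norm_eq_abs, abs_le]
  constructor <;> nlinarith [sq_nonneg (ψ i x + ψ j x), sq_nonneg (ψ i x - ψ j x)]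

section Sampling

variable {n : Type*} [Fintype n] {X : Type*} [MeasurableSpace X] {ψ : n → X → ℝ} {ν : Measure X}

lemma dotProduct_gram_mulVec (hψ : ∀ j, Measurable (ψ j)) {Q : Set X} (hQ : MeasurableSet Q)
    {μ : ℝ} (hμ : ∀ j, ∀ x ∈ Q, ψ j x ^ 2 ≤ μ) (y : n → ℝ) :
    y ⬝ᵥ (Matrix.of fun i j => ∫ x, ψ i x * ψ j x ∂ν[|Q]).mulVec y
      = ∫ x, sqComb ψ y x ∂ν[|Q] := by
  have hI := integrable_mul_cond (ν := ν) hψ hQ hμ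
  simp only [dotProduct_mulVec_eq_sum, sqComb_eq_sum, Matrix.of_apply]
  rw [integral_finsetSum _ fun i _ =>
    integrable_finsetSum _ fun j _ => (hI i j).const_mul _]
  refine Finset.sum_congr rfl fun i _ => ?_
  rw [integral_finsetSum _ fun j _ => (hI i j).const_mul _]
  refine Finset.sum_congr rfl fun j _ => ?_
  rw [integral_const_mul]

variable [IsProbabilityMeasure ν] {Ω : Type*} [MeasurableSpace Ω] {Pr : Measure Ω}
  [IsProbabilityMeasure Pr] [DecidableEq n]

/-- Two-sided deviation bound for the empirical Gram form at a fixed sparse unit vector. -/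
lemma measureReal_abs_gramError_le (hψ : ∀ j, Measurable (ψ j)) {Q : Set X} (hQ : MeasurableSet Q)
    (hν : ν Q ≠ 0) {μ : ℝ} (hμ : ∀ j, ∀ x ∈ Q, ψ j x ^ 2 ≤ μ) {ε : ℝ} {G : Matrix n n ℝ}
    (hGdef : G = Matrix.of fun i j => ∫ x, ψ i x * ψ j x ∂ν[|Q])
    (hG : ‖Matrix.toEuclideanCLM (n := n) (𝕜 := ℝ) (G - 1)‖ ≤ ε)
    {N : ℕ} (hN : 1 ≤ N) {ξ : Fin N → Ω → X} (hlaw : ∀ i, HasLaw (ξ i) ν Pr)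
    (hind : iIndepFun ξ Pr) {S : Finset n} (hL : 0 < S.card * μ) {z : n → ℝ}
    (hz : ∀ j ∉ S, z j = 0) (hz1 : ∑ j, z j ^ 2 = 1) {a : ℝ} (ha0 : 0 ≤ a) (ha1 : a ≤ 1) (t : ℝ) :
    Pr.real {ω | (∀ i, ξ i ω ∈ Q) ∧ t < |z ⬝ᵥ (gramError ψ G fun i => ξ i ω).mulVec z|}
      ≤ 2 * Real.exp (N * (a ^ 2 * (1 + ε) - a * t) / (S.card * μ)) := by
  set m := ∫ x, sqComb ψ z x ∂ν[|Q] with hm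
  have hN0 : (0 : ℝ) < N := by exact_mod_cast hN
  have hGm : z ⬝ᵥ G.mulVec z = m := by rw [hGdef, dotProduct_gram_mulVec hψ hQ hμ]
  have hm1 : m ≤ 1 + ε := by
    have h := abs_dotProduct_mulVec_sub_le G z
    rw [hGm, hz1, mul_one] at h
    linarith [(abs_le.1 (h.trans hG)).2]
  have key : ∀ b : ℝ, |b| = a →
      Pr.real {ω | (∀ i, ξ i ω ∈ Q) ∧ N * (b * m) + N * (a * t) ≤ b * ∑ i, sqComb ψ z (ξ i ω)}
        ≤ Real.exp (N * (a ^ 2 * (1 + ε) - a * t) / (S.card * μ)) := by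
    intro b hb
    refine (measureReal_chernoff_truncated hQ hν (measurable_sqComb ψ hψ z) hL
      (fun x _ => sqComb_nonneg ψ z x) (fun x hx => sqComb_le ψ hz hz1 fun j => hμ j x hx)
      hlaw hind (hb.trans_le ha1) _).trans ?_
    rw [← hm]
    -- The terms `b * m` cancel; only `a² m ≤ a² (1 + ε)` survives, for both signs of `b`.
    have hb2 : b ^ 2 = a ^ 2 := by rw [← sq_abs, hb]
    gcongr
    rw [hb2]
    have := mul_le_mul_of_nonneg_left hm1 (mul_nonneg hN0.le (sq_nonneg a))
    linarith
  have hsub : {ω | (∀ i, ξ i ω ∈ Q) ∧ t < |z ⬝ᵥ (gramError ψ G fun i => ξ i ω).mulVec z|}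
      ⊆ {ω | (∀ i, ξ i ω ∈ Q) ∧ N * (a * m) + N * (a * t) ≤ a * ∑ i, sqComb ψ z (ξ i ω)}
      ∪ {ω | (∀ i, ξ i ω ∈ Q) ∧ N * (-a * m) + N * (a * t) ≤ -a * ∑ i, sqComb ψ z (ξ i ω)} := by
    rintro ω ⟨hω, hd⟩
    rw [dotProduct_gramError_mulVec, hGm, lt_abs] at hd
    have hs : ∑ i, sqComb ψ z (ξ i ω) = N * ((N : ℝ)⁻¹ * ∑ i, sqComb ψ z (ξ i ω)) := by
      field_simp
    have hNa : 0 ≤ N * a := mul_nonneg hN0.le ha0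
    rcases hd with hd | hd
    · refine Or.inl ⟨hω, ?_⟩
      have := mul_le_mul_of_nonneg_left hd.le hNa
      rw [hs]
      linarith
    · refine Or.inr ⟨hω, ?_⟩
      have := mul_le_mul_of_nonneg_left hd.le hNa
      rw [hs]
      linarith
  have h1 := key a (abs_of_nonneg ha0)
  have h2 := key (-a) (by rw [abs_neg, abs_of_nonneg ha0])
  have h3 := (measureReal_mono (μ := Pr) hsub).trans (measureReal_union_le _ _)
  linarith

/-- Union bound over all supports and test vectors. -/
lemma pow_le_measureReal_ric_le (hψ : ∀ j, Measurable (ψ j)) {Q : Set X} (hQ : MeasurableSet Q)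
    (hν : ν Q ≠ 0) {μ : ℝ} (hμ : ∀ j, ∀ x ∈ Q, ψ j x ^ 2 ≤ μ) (hμ0 : 0 < μ) {ε : ℝ}
    (hG : ‖Matrix.toEuclideanCLM (n := n) (𝕜 := ℝ)
      ((Matrix.of fun i j => ∫ x, ψ i x * ψ j x ∂ν[|Q]) - 1)‖ ≤ ε)
    {N s : ℕ} (hN : 1 ≤ N) (hs : 1 ≤ s) (hsn : s ≤ Fintype.card n) {ξ : Fin N → Ω → X}
    (hlaw : ∀ i, HasLaw (ξ i) ν Pr) (hind : iIndepFun ξ Pr) {a : ℝ} (ha0 : 0 ≤ a) (ha1 : a ≤ 1)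
    {t : ℝ} (ht : 0 ≤ t) :
    ν.real Q ^ N ≤ Pr.real {ω | ric s ((√(N : ℝ))⁻¹ • samplingMatrix ψ fun i => ξ i ω)
        ≤ 32 * t + ε}
      + (Fintype.card n).choose s * (5 ^ s * (2 * Real.exp (N * (a ^ 2 * (1 + ε) - a * t)
          / (s * μ)))) := by
  set G : Matrix n n ℝ := Matrix.of fun i j => ∫ x, ψ i x * ψ j x ∂ν[|Q] with hGdef
  choose T hcard hT1 hT0 hT using fun S : Finset n => exists_testVectors S
  set β := 2 * Real.exp (N * (a ^ 2 * (1 + ε) - a * t) / (s * μ)) with hβ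
  have hβ0 : 0 ≤ β := by positivity
  let bad : (n → ℝ) → Set Ω := fun z =>
    {ω | (∀ i, ξ i ω ∈ Q) ∧ t < |z ⬝ᵥ (gramError ψ G fun i => ξ i ω).mulVec z|}
  let F := Finset.powersetCard s (Finset.univ : Finset n)
  have hsub : {ω | ∀ i, ξ i ω ∈ Q}
      ⊆ {ω | ric s ((√(N : ℝ))⁻¹ • samplingMatrix ψ fun i => ξ i ω) ≤ 32 * t + ε}
        ∪ ⋃ S ∈ F, ⋃ z ∈ T S, bad z := by
    intro ω hω
    by_cases hb : ω ∈ ⋃ S ∈ F, ⋃ z ∈ T S, bad z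
    · exact Or.inr hb
    · refine Or.inl (ric_le_of_testVectors ψ hsn hG ht _ T hT fun S hS z hz => ?_)
      by_contra! hlt
      refine hb (Set.mem_iUnion₂.2 ⟨S, Finset.mem_powersetCard.2 ⟨Finset.subset_univ S, hS⟩,
        Set.mem_iUnion₂.2 ⟨z, hz, hω, hlt⟩⟩)
  have hbad : ∀ S ∈ F, ∀ z ∈ T S, Pr.real (bad z) ≤ β := by
    intro S hS z hz
    have hSc : S.card = s := (Finset.mem_powersetCard.1 hS).2
    have hs0 : (0 : ℝ) < s := by exact_mod_cast hs
    have h := measureReal_abs_gramError_le (S := S) hψ hQ hν hμ hGdef hG hN hlaw hind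
      (by rw [hSc]; positivity) (hT0 S z hz) (hT1 S z hz) ha0 ha1 t
    rwa [hSc] at h
  have hF : Pr.real (⋃ S ∈ F, ⋃ z ∈ T S, bad z) ≤ (Fintype.card n).choose s * (5 ^ s * β) := by
    have hS : ∀ S ∈ F, Pr.real (⋃ z ∈ T S, bad z) ≤ 5 ^ s * β := by
      intro S hS
      have hSc : S.card = s := (Finset.mem_powersetCard.1 hS).2
      refine (measureReal_biUnion_finset_le _ _).trans
        ((Finset.sum_le_card_nsmul _ _ _ (hbad S hS)).trans ?_)
      rw [nsmul_eq_mul]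
      have : ((T S).card : ℝ) ≤ 5 ^ s := by
        have := hcard S
        rw [hSc] at this
        exact_mod_cast this
      gcongr
    refine (measureReal_biUnion_finset_le _ _).trans
      ((Finset.sum_le_card_nsmul _ _ _ hS).trans ?_)
    rw [nsmul_eq_mul, Finset.card_powersetCard, Finset.card_univ]
  rw [← measureReal_forall_mem_eq_pow hQ hlaw hind]
  exact ((measureReal_mono hsub).trans (measureReal_union_le _ _)).trans (by gcongr)

end Sampling

/-- Numerical part of the sample size condition: it makes the union bound at most `η`. -/
lemma union_bound_le {P s : ℕ} (hs : 1 ≤ s) (hsP : s ≤ P) {η : ℝ} (hη : 0 < η) (hη1 : η ≤ 1)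
    {x : ℝ} (hx : 4 * (s + Real.log (2 * s) + s * Real.log ((P : ℝ) / s) - Real.log η) ≤ x) :
    (P.choose s : ℝ) * (5 ^ s * (2 * Real.exp (-x))) ≤ η := by
  have hs1 : (1 : ℝ) ≤ s := by exact_mod_cast hs
  have hl2 : 0 ≤ Real.log (2 * s) := Real.log_nonneg (by linarith)
  have hlP : 0 ≤ Real.log ((P : ℝ) / s) :=
    Real.log_nonneg ((one_le_div (by linarith)).2 (by exact_mod_cast hsP))
  have hlη : Real.log η ≤ 0 := Real.log_nonpos hη.le hη1
  have hslP : 0 ≤ s * Real.log ((P : ℝ) / s) := mul_nonneg (by linarith) hlP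
  have he := Real.exp_one_gt_d9
  have h5 : (5 : ℝ) ^ s ≤ Real.exp (s * 2) := by
    rw [Real.exp_nat_mul]
    have : Real.exp 2 = Real.exp 1 * Real.exp 1 := by rw [← Real.exp_add]; norm_num
    gcongr
    rw [this]
    nlinarith
  have h2 : (2 : ℝ) ≤ Real.exp 1 := by linarith
  calc (P.choose s : ℝ) * (5 ^ s * (2 * Real.exp (-x)))
      ≤ Real.exp (s + s * Real.log ((P : ℝ) / s))
          * (Real.exp (s * 2) * (Real.exp 1 * Real.exp (-x))) := by
        gcongr
        exact choose_le_exp hs hsP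
    _ = Real.exp (s + s * Real.log ((P : ℝ) / s) + (s * 2 + (1 + -x))) := by
        rw [← Real.exp_add, ← Real.exp_add, ← Real.exp_add]
    -- The constants cost `3 s + 1 ≤ 4 s`, which the factor `4` in the hypothesis pays for; its
    -- other surplus terms are nonnegative.
    _ ≤ Real.exp (Real.log η) := by
        rw [Real.exp_le_exp]
        linarith
    _ = η := Real.exp_log hη

/-! ### The Hermite system. -/

lemma measurable_basisFun {d p : ℕ} (i : MultiIndex d p) : Measurable (basisFun i) := by
  unfold basisFun hermiteNormalized
  have h : ∀ k : ℕ, Measurable fun x : ℝ => Polynomial.aeval x (Polynomial.hermite k) := fun k =>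
    (Polynomial.continuous_aeval _).measurable
  exact Finset.measurable_fun_prod _ fun k _ =>
    ((h _).comp (measurable_pi_apply k)).div_const _

instance (d : ℕ) : IsProbabilityMeasure (inputLaw d) := by
  unfold inputLaw
  infer_instance

lemma basisFun_sq_le_coherence {d p : ℕ} {Q : Set (Fin d → ℝ)} (h : coherence d p Q ≠ ∞)
    (j : MultiIndex d p) {x : Fin d → ℝ} (hx : x ∈ Q) :
    basisFun j x ^ 2 ≤ (coherence d p Q).toReal := by
  have h1 : ENNReal.ofReal (|basisFun j x| ^ 2) ≤ coherence d p Q :=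
    (le_iSup₂ (f := fun ξ (_ : ξ ∈ Q) => ENNReal.ofReal (|basisFun j ξ| ^ 2)) x hx).trans
      (le_iSup (fun k : MultiIndex d p =>
        ⨆ ξ ∈ Q, ENNReal.ofReal (|basisFun k ξ| ^ 2)) j)
  rw [← sq_abs]
  exact (ENNReal.ofReal_le_iff_le_toReal h).1 h1

/-- The zero multi-index gives the constant function `1`. -/
lemma one_le_coherence {d p : ℕ} {Q : Set (Fin d → ℝ)} (h : coherence d p Q ≠ ∞)
    (hQ : Q.Nonempty) : 1 ≤ (coherence d p Q).toReal := by
  obtain ⟨x, hx⟩ := hQ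
  have h1 := basisFun_sq_le_coherence (p := p) h ⟨fun _ => 0, by simp⟩ hx
  simpa [basisFun, hermiteNormalized] using h1

end SparsePCE

theorem mainTheorem4 (ε₀ τ : ℝ) (hε₀ : 0 ≤ ε₀) (hτ : ε₀ < τ) :
    ∃ C : ℝ, 0 < C ∧
      ∀ (d p s N : ℕ) (Q : Set (Fin d → ℝ)) (δstar pstar : ℝ)
        (Ω : Type*) [MeasurableSpace Ω] (Pr : Measure Ω) [IsProbabilityMeasure Pr]
        (ξ : Fin N → Ω → Fin d → ℝ),
        -- the samples are independent copies of the random input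
        (∀ i, HasLaw (ξ i) (SparsePCE.inputLaw d) Pr) → iIndepFun ξ Pr →
        1 ≤ N → 1 ≤ s → s ≤ SparsePCE.numBasis d p →
        -- the truncation set
        MeasurableSet Q → SparsePCE.coherence d p Q ≠ ∞ →
        SparsePCE.truncationBias d p Q ≤ ε₀ →
        -- the threshold and the target probability
        τ ≤ δstar → 0 ≤ pstar → pstar < (SparsePCE.inputLaw d).real Q ^ N →
        -- the sample size condition
        (N : ℝ) * δstar ≥
          (s : ℝ) * (SparsePCE.coherence d p Q).toReal / C *
            ((s : ℝ) + Real.log (2 * s) + s * Real.log ((SparsePCE.numBasis d p : ℝ) / s)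
              - Real.log ((SparsePCE.inputLaw d).real Q ^ N - pstar)) →
        Pr.real {ω | SparsePCE.ric s
          ((√(N : ℝ))⁻¹ • SparsePCE.measurementMatrix p fun i => ξ i ω) < δstar} ≥ pstar := by
  open SparsePCE in
  have hτ0 : 0 < τ := hε₀.trans_lt hτ
  -- Chosen so that `κ * δ ≤ (δ - ε₀) / 64` for all `δ ≥ τ`, with equality at `τ`.
  set κ : ℝ := (1 - ε₀ / τ) / 64 with hκ
  have hκ0 : 0 < κ := by
    have : ε₀ / τ < 1 := (div_lt_one hτ0).2 hτ
    rw [hκ]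
    linarith
  -- Makes `a² (1 + ε₀) ≤ a t / 2` for every admissible threshold, so at least half of the linear
  -- term `a t` survives.
  set a : ℝ := min 1 ((τ - ε₀) / 64 / (2 * (1 + ε₀))) with ha
  have ha0 : 0 < a := lt_min one_pos (by have := sub_pos.2 hτ; positivity)
  have ha1 : a ≤ 1 := min_le_left _ _
  have ha2 : a * (1 + ε₀) ≤ (τ - ε₀) / 64 / 2 := by
    have h : a ≤ (τ - ε₀) / 64 / (2 * (1 + ε₀)) := min_le_right _ _
    rw [le_div_iff₀ (by positivity)] at h
    linarith
  -- `8 = 2 * 4`: the halved exponent times the factor `4` of `union_bound_le`.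
  refine ⟨a * κ / 8, by positivity, ?_⟩
  intro d p s N Q δstar pstar Ω _ Pr _ ξ hlaw hind hN hs hsP hQ hcoh hbias hδ hp0 hp hsize
  have hN0 : (0 : ℝ) < N := by exact_mod_cast hN
  have hs0 : (0 : ℝ) < s := by exact_mod_cast hs
  have hν : inputLaw d Q ≠ 0 := by
    intro h
    rw [Measure.real, h, ENNReal.toReal_zero, zero_pow (by omega)] at hp
    linarith
  have hμ0 : 0 < (coherence d p Q).toReal :=
    one_pos.trans_le (one_le_coherence hcoh (nonempty_of_measure_ne_zero hν))
  set L : ℝ := s * (coherence d p Q).toReal with hL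
  have hL0 : 0 < L := by positivity
  -- With this `t`, `32 * t + ε₀` is the midpoint of `ε₀` and `δstar`, hence strictly below `δstar`.
  set t : ℝ := (δstar - ε₀) / 64 with ht
  have htκ : κ * δstar ≤ t := by
    have h1 : ε₀ ≤ ε₀ / τ * δstar := by
      rw [div_mul_eq_mul_div, le_div_iff₀ hτ0]
      exact mul_le_mul_of_nonneg_left hδ hε₀
    rw [hκ, ht]
    linarith
  have ht0 : 0 ≤ t := by rw [ht]; linarith
  have hmain := pow_le_measureReal_ric_le (ψ := fun j : MultiIndex d p => basisFun j)
    measurable_basisFun hQ hν (fun j x hx => basisFun_sq_le_coherence hcoh j hx) hμ0 hbias hN hs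
    hsP hlaw hind ha0.le ha1 ht0
  set η : ℝ := (inputLaw d).real Q ^ N - pstar with hη
  have hη0 : 0 < η := sub_pos.2 hp
  have hη1 : η ≤ 1 := by
    have : (inputLaw d).real Q ^ N ≤ 1 := pow_le_one₀ measureReal_nonneg measureReal_le_one
    linarith
  have hexp : Real.exp (N * (a ^ 2 * (1 + ε₀) - a * t) / L)
      ≤ Real.exp (-(N * (a * (κ * δstar)) / (2 * L))) := by
    rw [Real.exp_le_exp, ← neg_div, div_le_div_iff₀ hL0 (by positivity)]
    have h1 : a * (1 + ε₀) ≤ t / 2 := ha2.trans (by rw [ht]; linarith)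
    have h2 := mul_le_mul_of_nonneg_left h1 ha0.le
    have h3 := mul_le_mul_of_nonneg_left htκ ha0.le
    have h4 : 2 * (a ^ 2 * (1 + ε₀) - a * t) ≤ -(a * (κ * δstar)) := by linarith
    have h5 := mul_le_mul_of_nonneg_left h4 (mul_nonneg hN0.le hL0.le)
    linarith
  have hx : 4 * (s + Real.log (2 * s) + s * Real.log ((numBasis d p : ℝ) / s) - Real.log η)
      ≤ N * (a * (κ * δstar)) / (2 * L) := by
    rw [ge_iff_le, div_mul_eq_mul_div, div_le_iff₀ (by positivity)] at hsize
    rw [le_div_iff₀ (by positivity)]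
    linarith
  have hub := union_bound_le hs hsP hη0 hη1 hx
  have hub' : ((Fintype.card (MultiIndex d p)).choose s : ℝ)
      * (5 ^ s * (2 * Real.exp (N * (a ^ 2 * (1 + ε₀) - a * t) / L))) ≤ η := by
    refine le_trans ?_ hub
    unfold numBasis
    gcongr
  have hsub : {ω | ric s ((√(N : ℝ))⁻¹ • samplingMatrix (fun j : MultiIndex d p => basisFun j)
      fun i => ξ i ω) ≤ 32 * t + ε₀}
      ⊆ {ω | ric s ((√(N : ℝ))⁻¹ • measurementMatrix p fun i => ξ i ω) < δstar} := by
    intro ω hω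
    refine lt_of_le_of_lt (show ric s ((√(N : ℝ))⁻¹ • measurementMatrix p fun i => ξ i ω)
      ≤ 32 * t + ε₀ from hω) ?_
    rw [ht]
    linarith
  have hmono := measureReal_mono (μ := Pr) hsub
  linarith
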